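/- Let $X$, $Y$, $\partial X$ be complex Banach spaces with $Y\hookrightarrow X$ (a continuous injective linear embedding, by which $Y$ is regarded as a subspace of $X$). Let $A:D(A)\to X$ be linear with $D(A)\subset Y$, let $R:D(A)\to\partial X$ be linear and surjective, and let $B_1,B_2\in\mathcal L(Y,\partial X)$ and $B_3,B_4\in\mathcal L(\partial X)$. Assume that $\binom{A}{R}:D(A)\subset Y\to X\times\partial X$ is closed, and that $A_0:=A|_{\ker R}$ generates a cosine operator function on $X$ with associated phase space $Y\times X$ (that is, moreover $\begin{pmatrix}0&I_Y\\A_0&0\end{pmatrix}$ with domain $D(A_0)\times Y$ generates a $C_0$-semigroup on $Y\times X$). Put $L:=R+B_2:D(A)\to\partial X$ and $\mathbb X:=Y\times X\times\partial X$. Define $$\mathbb A:=\begin{pmatrix}0&I_Y&0\\A&0&0\\L&0&0\end{pmatrix},\quad D(\mathbb A):=D(A)\times Y\times\partial X,\qquad \mathbb R:=\begin{pmatrix}R&0&0\end{pmatrix}:D(\mathbb A)\to\partial X,$$ $$\mathbb B:=\begin{pmatrix}B_1+B_4B_2&0&B_3\end{pmatrix}:\mathbb X\to\partial X,\qquad \mathbb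 A_0:=\mathbb A|_{\ker\mathbb R}\ \text{ on }\mathbb X,$$ and, on $\mathcal X:=\mathbb X\times\partial X$, the operator $$\mathcal A:=\begin{pmatrix}\mathbb A&0\\\mathbb B&B_4\end{pmatrix},\qquad D(\mathcal A):=\left\{\binom{\mathbb u}{\mathbb x}\in D(\mathbb A)\times\partial X:\ \mathbb R\mathbb u=\mathbb x\right\}.$$ For an operator $T$ on a Banach space let $\sigma_{\rm ess}(T)$ be the set of $\mu\in\mathbb C$ for which $T-\mu$ is not Fredholm, where an operator is Fredholm if it is closed, its kernel is finite dimensional, and its range is closed and of finite codimension; its index is $\operatorname{ind}=\dim\ker-\operatorname{codim}\operatorname{range}$. If $\partial X$ is finite dimensional, then $$\sigma_{\rm ess}(\mathcal A)=\sigma_{\rm ess}(\mathbb A_0),$$ and $$\operatorname{ind}(\mathcal A-\mu)=\operatorname{ind}(\mathbb A_0-\mu)\qquad\text{for all }\mu\notin\sigma_{\rm ess}(\mathbb A_0).$$ -/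

import Mathlib

open Filter Topology
open scoped NNReal

noncomputable section

namespace Acoustic

/-! ### Generators of semigroups and of cosine functions -/

section Generators

variable {E : Type*} [NormedAddCommGroup E] [NormedSpace ℂ E]

/-- Strongly continuous one-parameter semigroups of bounded operators. -/
structure IsC0Semigroup (T : ℝ≥0 → E →L[ℂ] E) : Prop where
  zero : T 0 = ContinuousLinearMap.id ℂ E
  add : ∀ s t, T (s + t) = (T s).comp (T t)
  strongly_continuous : ∀ x, Continuous fun t => T t x

/-- `G` generates a strongly continuous semigroup `T`: the domain of `G` consists exactly of the
`x` for which `(T t x - x) / t` converges as `t ↓ 0`, and the limit is `G x`. -/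
def GeneratesC0Semigroup (G : E →ₗ.[ℂ] E) : Prop :=
  ∃ T : ℝ≥0 → E →L[ℂ] E, IsC0Semigroup T ∧
    ∀ x y : E, (x, y) ∈ G.graph ↔
      Tendsto (fun t : ℝ≥0 => (((t : ℝ)⁻¹ : ℝ) : ℂ) • (T t x - x)) (𝓝[>] 0) (𝓝 y)

/-- Strongly continuous cosine operator functions. -/
structure IsCosineFunction (C : ℝ → E →L[ℂ] E) : Prop where
  zero : C 0 = ContinuousLinearMap.id ℂ E
  dAlembert : ∀ s t, C (t + s) + C (t - s) = (2 : ℂ) • (C t).comp (C s)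
  strongly_continuous : ∀ x, Continuous fun t => C t x

/-- `G` generates a cosine operator function `C`: the domain of `G` consists exactly of the
`x` for which `2 (C t x - x) / t ^ 2` converges as `t → 0`, and the limit is `G x`. -/
def GeneratesCosineFunction (G : E →ₗ.[ℂ] E) : Prop :=
  ∃ C : ℝ → E →L[ℂ] E, IsCosineFunction C ∧
    ∀ x y : E, (x, y) ∈ G.graph ↔
      Tendsto (fun t : ℝ => ((2 / t ^ 2 : ℝ) : ℂ) • (C t x - x)) (𝓝[≠] 0) (𝓝 y)

end Generators

/-! ### Unbounded Fredholm operators and the essential spectrum -/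

section Fredholm

variable {E F : Type*} [NormedAddCommGroup E] [NormedSpace ℂ E]
  [NormedAddCommGroup F] [NormedSpace ℂ F]

/-- The operator `T - μ`, with the same domain as `T`. -/
def subScalar (T : E →ₗ.[ℂ] E) (μ : ℂ) : E →ₗ.[ℂ] E :=
  ⟨T.domain, T.toFun - μ • T.domain.subtype⟩

/-- A (possibly unbounded) operator is Fredholm if it is closed, has a finite-dimensional kernel,
and its range is closed and of finite codimension. -/
structure IsFredholm (T : E →ₗ.[ℂ] F) : Prop where
  closed : T.IsClosed
  finite_ker : FiniteDimensional ℂ (LinearMap.ker T.toFun)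
  closed_range : IsClosed (LinearMap.range T.toFun : Set F)
  finite_coker : FiniteDimensional ℂ (F ⧸ LinearMap.range T.toFun)

/-- The Fredholm index `dim ker T - codim range T` (meaningful for Fredholm operators). -/
def fredholmIndex (T : E →ₗ.[ℂ] F) : ℤ :=
  (Module.finrank ℂ (LinearMap.ker T.toFun) : ℤ) -
    (Module.finrank ℂ (F ⧸ LinearMap.range T.toFun) : ℤ)

/-- The essential spectrum: all `μ` such that `T - μ` is not Fredholm. -/
def essentialSpectrum (T : E →ₗ.[ℂ] E) : Set ℂ :=
  {μ | ¬ IsFredholm (subScalar T μ)}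

end Fredholm

/-! ### The abstract setting -/

/-- The spaces and operators: an embedding `ι : Y ↪ X`, a linear operator `A : D(A) → X` with
`D(A) ⊆ Y`, a linear operator `R : D(A) → ∂X` and bounded operators `B₁, B₂ : Y → ∂X`,
`B₃, B₄ : ∂X → ∂X`. The boundary space `∂X` is called `dX`. -/
structure Data (X Y dX : Type*)
    [NormedAddCommGroup X] [NormedSpace ℂ X] [NormedAddCommGroup Y] [NormedSpace ℂ Y]
    [NormedAddCommGroup dX] [NormedSpace ℂ dX] where
  ι : Y →L[ℂ] X
  ι_injective : Function.Injective ι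
  A : Y →ₗ.[ℂ] X
  R : A.domain →ₗ[ℂ] dX
  B₁ : Y →L[ℂ] dX
  B₂ : Y →L[ℂ] dX
  B₃ : dX →L[ℂ] dX
  B₄ : dX →L[ℂ] dX

namespace Data

variable {X Y dX : Type*}
  [NormedAddCommGroup X] [NormedSpace ℂ X] [NormedAddCommGroup Y] [NormedSpace ℂ Y]
  [NormedAddCommGroup dX] [NormedSpace ℂ dX] (S : Data X Y dX)

/-- `Y` regarded as a subspace of `X`. -/
def YinX : Submodule ℂ X := LinearMap.range (S.ι : Y →ₗ[ℂ] X)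

/-- The identification of the subspace `Y` of `X` with the Banach space `Y`. -/
def toY : S.YinX →ₗ[ℂ] Y :=
  (LinearEquiv.ofInjective (S.ι : Y →ₗ[ℂ] X) S.ι_injective).symm.toLinearMap

/-- `L = R + B₂` on `D(A)`. -/
def L : S.A.domain →ₗ[ℂ] dX := S.R + (S.B₂ : Y →ₗ[ℂ] dX).comp S.A.domain.subtype

/-- The operator `(A, R) : D(A) ⊆ Y → X × ∂X`. -/
def AR : Y →ₗ.[ℂ] X × dX := ⟨S.A.domain, S.A.toFun.prod S.R⟩

/-- The subspace `ker R` of `Y`. -/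
def kerR : Submodule ℂ Y := (LinearMap.ker S.R).map S.A.domain.subtype

/-- The restriction of `A` to `ker R`, as an operator from `Y` to `X`. -/
def A₀Y : Y →ₗ.[ℂ] X := S.A.domRestrict S.kerR

/-- The restriction `A₀` of `A` to `ker R`, as an operator on `X`. -/
def A₀ : X →ₗ.[ℂ] X :=
  ⟨S.A₀Y.domain.map (S.ι : Y →ₗ[ℂ] X),
    S.A₀Y.toFun.comp
      (Submodule.equivMapOfInjective (S.ι : Y →ₗ[ℂ] X) S.ι_injective
        S.A₀Y.domain).symm.toLinearMap⟩

/-- The operator matrix `(0, I_Y; A₀, 0)` on `Y × X` with domain `D(A₀) × Y`. -/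
def phaseOperator : Y × X →ₗ.[ℂ] Y × X where
  domain := S.A₀Y.domain.prod S.YinX
  toFun :=
    (S.toY.comp
        (((LinearMap.snd ℂ Y X).comp (S.A₀Y.domain.prod S.YinX).subtype).codRestrict
          S.YinX fun p => p.2.2)).prod
      (S.A₀Y.toFun.comp
        (((LinearMap.fst ℂ Y X).comp (S.A₀Y.domain.prod S.YinX).subtype).codRestrict
          S.A₀Y.domain fun p => p.2.1))

/-- `A₀` generates a cosine operator function on `X` with associated phase space `Y × X`.
The second factor `X` being fixed, the phase space is characterized by the property that
`(0, I_Y; A₀, 0)` with domain `D(A₀) × Y` generates a strongly continuous semigroup on it. -/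
def HasPhaseSpace : Prop :=
  GeneratesCosineFunction S.A₀ ∧ GeneratesC0Semigroup S.phaseOperator

/-- The standing assumptions on the data: besides what is built into `Data`, the operator `R` is
surjective, `(A, R)` is closed, and `A₀` generates a cosine function with phase space `Y × X`. -/
structure Assumptions : Prop where
  R_surjective : Function.Surjective S.R
  AR_closed : S.AR.IsClosed
  phase_space : S.HasPhaseSpace

/-- The domain `D(A) × Y × ∂X` of the operator matrix `𝔸`. -/
def bbDomain : Submodule ℂ (Y × X × dX) :=
  S.A.domain.prod (S.YinX.prod ⊤)

/-- The first coordinate `D(𝔸) → D(A)`. -/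
def bbFst : S.bbDomain →ₗ[ℂ] S.A.domain :=
  ((LinearMap.fst ℂ Y (X × dX)).comp S.bbDomain.subtype).codRestrict S.A.domain fun p => p.2.1

/-- The second coordinate `D(𝔸) → Y ⊆ X`. -/
def bbSnd : S.bbDomain →ₗ[ℂ] S.YinX :=
  ((LinearMap.fst ℂ X dX).comp
    ((LinearMap.snd ℂ Y (X × dX)).comp S.bbDomain.subtype)).codRestrict S.YinX fun p => p.2.2.1

/-- The operator matrix `𝔸 = (0, I_Y, 0; A, 0, 0; L, 0, 0)` on `𝕏 = Y × X × ∂X`,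
that is `(u, v, x) ↦ (v, A u, L u)`, with domain `D(A) × Y × ∂X`. -/
def bbA : Y × X × dX →ₗ.[ℂ] Y × X × dX :=
  ⟨S.bbDomain, (S.toY.comp S.bbSnd).prod ((S.A.toFun.comp S.bbFst).prod (S.L.comp S.bbFst))⟩

/-- The operator `ℝ = (R, 0, 0) : D(𝔸) → ∂X`. -/
def bbR : Y × X × dX →ₗ.[ℂ] dX := ⟨S.bbDomain, S.R.comp S.bbFst⟩

/-- The bounded operator `𝔹 = (B₁ + B₄ B₂, 0, B₃) : 𝕏 → ∂X`. -/
def bbB : Y × X × dX →L[ℂ] dX :=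
  (S.B₁ + S.B₄.comp S.B₂).comp (ContinuousLinearMap.fst ℂ Y (X × dX)) +
    S.B₃.comp ((ContinuousLinearMap.snd ℂ X dX).comp (ContinuousLinearMap.snd ℂ Y (X × dX)))

/-- The restriction `𝔸₀` of `𝔸` to `ker ℝ`. -/
def bbA₀ : Y × X × dX →ₗ.[ℂ] Y × X × dX :=
  S.bbA.domRestrict ((LinearMap.ker S.bbR.toFun).map S.bbR.domain.subtype)

/-- The operator matrix `𝒜 = (𝔸, 0; 𝔹, B₄)` on `𝒳 = 𝕏 × ∂X` with domain
`{(u, x) | u ∈ D(𝔸), ℝ u = x}`, i.e. the graph of `ℝ`. -/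
def calA : (Y × X × dX) × dX →ₗ.[ℂ] (Y × X × dX) × dX where
  domain := S.bbR.graph
  toFun :=
    (S.bbA.toFun.comp
        (((LinearMap.fst ℂ (Y × X × dX) dX).comp S.bbR.graph.subtype).codRestrict
          S.bbA.domain fun p => LinearPMap.mem_domain_of_mem_graph (f := S.bbR) p.2)).prod
      (((S.bbB : Y × X × dX →ₗ[ℂ] dX).coprod (S.B₄ : dX →ₗ[ℂ] dX)).comp S.bbR.graph.subtype)

end Data

end Acoustic

end

/-! Both operators are compared with `bbA` on its full domain. Through the graph of `bbR`, the
domain of `calA` is a copy of the domain of `bbA`, and the first component of `calA - μ` is then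
`bbA - μ`, while `bbA₀ - μ` is `bbA - μ` composed with the inclusion of the kernel of `bbR`. If `∂X`
has dimension `n`, the projection onto `𝕏` has index `n` and, `R` being surjective, the inclusion
has index `-n`. Additivity of the index shows that both operators have the index of `bbA - μ` minus
`n`, and cancellation of finite-index factors shows that they have finite index simultaneously. The
topological conditions come for free: both graphs are cut out by continuous conditions from that of
`(A, R)`, hence closed, and a closed operator between Banach spaces whose range has finite
codimension has closed range (`isClosed_range_of_finite_coker`). -/

namespace Acoustic

open Module

/-! ### Algebra of linear maps of finite index -/

section FiniteIndex

variable {U V W : Type*} [AddCommGroup U] [Module ℂ U] [AddCommGroup V] [Module ℂ V]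
  [AddCommGroup W] [Module ℂ W]

/-- A linear map has finite index if its kernel and its cokernel are finite dimensional. -/
structure HasFiniteIndex (f : U →ₗ[ℂ] V) : Prop where
  finite_ker : FiniteDimensional ℂ (LinearMap.ker f)
  finite_coker : FiniteDimensional ℂ (V ⧸ LinearMap.range f)

lemma finiteDimensional_of_range_eq_ker [FiniteDimensional ℂ U] [FiniteDimensional ℂ W]
    (f : U →ₗ[ℂ] V) (g : V →ₗ[ℂ] W) (h : LinearMap.range f = LinearMap.ker g) :
    FiniteDimensional ℂ V :=
  have := isNoetherian_of_range_eq_ker f g h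
  inferInstance

lemma HasFiniteIndex.comp {f : U →ₗ[ℂ] V} {g : V →ₗ[ℂ] W} (hg : HasFiniteIndex g)
    (hf : HasFiniteIndex f) : HasFiniteIndex (g ∘ₗ f) := by
  have := hf.finite_ker
  have := hf.finite_coker
  have := hg.finite_ker
  have := hg.finite_coker
  exact ⟨by rw [LinearMap.ker_comp]; infer_instance, by rw [LinearMap.range_comp]; infer_instance⟩

/-- The sequence `ker (g ∘ f) → ker g → V / range f` is exact in the middle, and `W / range (g ∘ f)`
maps onto `W / range g`. -/
lemma HasFiniteIndex.of_comp_left {f : U →ₗ[ℂ] V} {g : V →ₗ[ℂ] W} (hf : HasFiniteIndex f)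
    (h : HasFiniteIndex (g ∘ₗ f)) : HasFiniteIndex g := by
  have := hf.finite_coker
  have := h.finite_ker
  have := h.finite_coker
  refine ⟨?_, ?_⟩
  · refine finiteDimensional_of_range_eq_ker
      (f.restrict (p := LinearMap.ker (g ∘ₗ f)) (q := LinearMap.ker g) (by simp))
      ((LinearMap.range f).mkQ ∘ₗ (LinearMap.ker g).subtype) ?_
    ext ⟨v, hv⟩
    simp only [LinearMap.mem_range, LinearMap.mem_ker, LinearMap.comp_apply, Subtype.exists,
      Submodule.subtype_apply, Submodule.mkQ_apply, Submodule.Quotient.mk_eq_zero]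
    constructor
    · rintro ⟨u, hu, h⟩
      exact ⟨u, congrArg Subtype.val h⟩
    · rintro ⟨u, rfl⟩
      exact ⟨u, hv, rfl⟩
  · exact Module.Finite.of_surjective
      (Submodule.factor (LinearMap.range_comp_le_range f g)) (Submodule.factor_surjective _)

/-- The cokernel is controlled by `ker g → V / range f → W / range (g ∘ f)`, exact in the middle. -/
lemma HasFiniteIndex.of_comp_right {f : U →ₗ[ℂ] V} {g : V →ₗ[ℂ] W} (hg : HasFiniteIndex g)
    (h : HasFiniteIndex (g ∘ₗ f)) : HasFiniteIndex f := by
  have := hg.finite_ker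
  have := h.finite_ker
  have := h.finite_coker
  refine ⟨Submodule.finiteDimensional_of_le (LinearMap.ker_le_ker_comp f g), ?_⟩
  have aux : LinearMap.range f ≤ (LinearMap.range (g ∘ₗ f)).comap g := by
    rw [← Submodule.map_le_iff_le_comap, LinearMap.range_comp]
  refine finiteDimensional_of_range_eq_ker ((LinearMap.range f).mkQ ∘ₗ (LinearMap.ker g).subtype)
    ((LinearMap.range f).mapQ (LinearMap.range (g ∘ₗ f)) g aux) ?_
  simp [LinearMap.range_comp, Submodule.ker_mapQ, Submodule.comap_map_eq]

lemma HasFiniteIndex.index_comp {f : U →ₗ[ℂ] V} {g : V →ₗ[ℂ] W} (hg : HasFiniteIndex g)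
    (hf : HasFiniteIndex f) : (g ∘ₗ f).index = g.index + f.index := by
  have := hf.finite_ker
  have := hf.finite_coker
  have := hg.finite_ker
  have := hg.finite_coker
  exact LinearMap.index_comp g

lemma hasFiniteIndex_linearEquiv (e : U ≃ₗ[ℂ] V) : HasFiniteIndex e.toLinearMap :=
  ⟨by rw [LinearEquiv.ker]; infer_instance, by rw [LinearEquiv.range]; infer_instance⟩

lemma hasFiniteIndex_fst [FiniteDimensional ℂ W] : HasFiniteIndex (LinearMap.fst ℂ V W) := by
  constructor
  · rw [LinearMap.ker_fst]
    infer_instance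
  · rw [LinearMap.range_eq_top.2 LinearMap.fst_surjective]
    infer_instance

lemma index_fst : (LinearMap.fst ℂ V W).index = finrank ℂ W := by
  rw [LinearMap.index_of_surjective LinearMap.fst_surjective, LinearMap.ker_fst,
    LinearMap.finrank_range_of_inj LinearMap.inr_injective]

/-- The cokernel of the inclusion of the kernel of a surjective linear map is its target. -/
noncomputable def cokerEquivOfRangeEqKer {j : U →ₗ[ℂ] V} {r : V →ₗ[ℂ] W} (hr : Function.Surjective r)
    (h : LinearMap.range j = LinearMap.ker r) : (V ⧸ LinearMap.range j) ≃ₗ[ℂ] W :=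
  (Submodule.quotEquivOfEq _ _ h).trans (r.quotKerEquivOfSurjective hr)

lemma hasFiniteIndex_of_range_eq_ker [FiniteDimensional ℂ W] {j : U →ₗ[ℂ] V} {r : V →ₗ[ℂ] W}
    (hj : Function.Injective j) (hr : Function.Surjective r)
    (h : LinearMap.range j = LinearMap.ker r) : HasFiniteIndex j :=
  ⟨by rw [LinearMap.ker_eq_bot.2 hj]; infer_instance,
    Module.Finite.equiv (cokerEquivOfRangeEqKer hr h).symm⟩

lemma index_of_range_eq_ker {j : U →ₗ[ℂ] V} {r : V →ₗ[ℂ] W}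
    (hj : Function.Injective j) (hr : Function.Surjective r)
    (h : LinearMap.range j = LinearMap.ker r) : j.index = -finrank ℂ W := by
  rw [LinearMap.index_of_injective hj, (cokerEquivOfRangeEqKer hr h).finrank_eq]

/-- Enlarging the target of `f` by a finite-dimensional space, and restricting `f` to the kernel of
a surjection onto the same space, lead to maps of finite index simultaneously. -/
lemma hasFiniteIndex_iff_of_fst_comp {U' Z : Type*} [AddCommGroup U'] [Module ℂ U']
    [AddCommGroup Z] [Module ℂ Z] [FiniteDimensional ℂ Z]
    {f : V →ₗ[ℂ] W} {j : U →ₗ[ℂ] V} {r : V →ₗ[ℂ] Z} (hj : Function.Injective j)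
    (hr : Function.Surjective r) (h : LinearMap.range j = LinearMap.ker r)
    {T : U' →ₗ[ℂ] W × Z} (e : U' ≃ₗ[ℂ] V) (hT : LinearMap.fst ℂ W Z ∘ₗ T = f ∘ₗ e.toLinearMap) :
    HasFiniteIndex T ↔ HasFiniteIndex (f ∘ₗ j) := by
  have hj' := hasFiniteIndex_of_range_eq_ker hj hr h
  have he := hasFiniteIndex_linearEquiv e
  have hfst : HasFiniteIndex (LinearMap.fst ℂ W Z) := hasFiniteIndex_fst
  -- In each direction, finite index passes through `f`: cancel one factor to reach `f`, then
  -- compose with or cancel the others.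
  exact ⟨fun hF => (he.of_comp_left (hT ▸ hfst.comp hF)).comp hj',
    fun hF => hfst.of_comp_right (hT ▸ (hj'.of_comp_left hF).comp he)⟩

/-- The maps of the previous lemma have the same index. -/
lemma index_eq_of_fst_comp {U' Z : Type*} [AddCommGroup U'] [Module ℂ U']
    [AddCommGroup Z] [Module ℂ Z] [FiniteDimensional ℂ Z]
    {f : V →ₗ[ℂ] W} {j : U →ₗ[ℂ] V} {r : V →ₗ[ℂ] Z} (hj : Function.Injective j)
    (hr : Function.Surjective r) (h : LinearMap.range j = LinearMap.ker r)
    {T : U' →ₗ[ℂ] W × Z} (e : U' ≃ₗ[ℂ] V) (hT : LinearMap.fst ℂ W Z ∘ₗ T = f ∘ₗ e.toLinearMap)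
    (hF : HasFiniteIndex (f ∘ₗ j)) : T.index = (f ∘ₗ j).index := by
  have hj' := hasFiniteIndex_of_range_eq_ker hj hr h
  have hf := hj'.of_comp_left hF
  have hTF := (hasFiniteIndex_iff_of_fst_comp hj hr h e hT).2 hF
  have h1 := hasFiniteIndex_fst.index_comp hTF
  -- Now `h1` says that the index of `f` is `dim Z` plus the index of `T`.
  rw [hT, hf.index_comp (hasFiniteIndex_linearEquiv e), LinearEquiv.index_eq_zero, index_fst] at h1
  rw [hf.index_comp hj', index_of_range_eq_ker hj hr h]
  linarith

end FiniteIndex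

/-! ### Closed operators and closed ranges -/

section Closed

variable {E F : Type*} [NormedAddCommGroup E] [NormedSpace ℂ E]
  [NormedAddCommGroup F] [NormedSpace ℂ F]

/-- The range of a closed operator between Banach spaces is closed if it has finite codimension. -/
lemma isClosed_range_of_finite_coker [CompleteSpace E] [CompleteSpace F] {T : E →ₗ.[ℂ] F}
    (hT : T.IsClosed) (hfin : FiniteDimensional ℂ (F ⧸ LinearMap.range T.toFun)) :
    IsClosed (LinearMap.range T.toFun : Set F) := by
  obtain ⟨G, hG⟩ := Submodule.exists_isCompl (LinearMap.range T.toFun)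
  have : FiniteDimensional ℂ G := Module.Finite.equiv (Submodule.quotientEquivOfIsCompl _ _ hG)
  -- Completeness of the graph is where closedness of `T` enters.
  have : CompleteSpace T.graph := IsClosed.completeSpace_coe (hs := hT)
  have : CompleteSpace G := FiniteDimensional.complete ℂ G
  have hmem (x : T.graph) : x.1.2 ∈ LinearMap.range T.toFun :=
    T.graph_map_snd_eq_range ▸ Submodule.mem_map_of_mem x.2
  let Φ : (T.graph × G) →L[ℂ] F :=
    ((ContinuousLinearMap.snd ℂ E F).comp T.graph.subtypeL).coprod G.subtypeL
  have hΦ (p : T.graph × G) : Φ p = p.1.1.2 + p.2.1 := rfl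
  have hsurj : Function.Surjective Φ := by
    intro w
    obtain ⟨_, ⟨x, rfl⟩, g, hg, rfl⟩ := Submodule.mem_sup.1
      (hG.sup_eq_top ▸ Submodule.mem_top : w ∈ LinearMap.range T.toFun ⊔ G)
    exact ⟨(⟨_, T.mem_graph x⟩, ⟨g, hg⟩), rfl⟩
  have hpre : Φ ⁻¹' (LinearMap.range T.toFun : Set F) = Prod.snd ⁻¹' {(0 : G)} := by
    ext p
    rw [Set.mem_preimage, SetLike.mem_coe, hΦ, Submodule.add_mem_iff_right _ (hmem p.1)]
    refine ⟨fun h => Subtype.ext (Submodule.disjoint_def.1 hG.disjoint _ h p.2.2), fun h => ?_⟩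
    rw [show p.2 = 0 from h]
    exact Submodule.zero_mem _
  rw [← (Φ.isQuotientMap hsurj).isClosed_preimage, hpre]
  exact isClosed_singleton.preimage continuous_snd

lemma isFredholm_iff_of_isClosed [CompleteSpace E] [CompleteSpace F] {T : E →ₗ.[ℂ] F}
    (hT : T.IsClosed) : IsFredholm T ↔ HasFiniteIndex T.toFun :=
  ⟨fun h => ⟨h.finite_ker, h.finite_coker⟩, fun h =>
    ⟨hT, h.finite_ker, isClosed_range_of_finite_coker hT h.finite_coker, h.finite_coker⟩⟩

lemma isClosed_subScalar {T : E →ₗ.[ℂ] E} (hT : T.IsClosed) (μ : ℂ) :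
    (subScalar T μ).IsClosed := by
  have h : ((subScalar T μ).graph : Set (E × E)) =
      (fun p : E × E => (p.1, p.2 + μ • p.1)) ⁻¹' (T.graph : Set (E × E)) := by
    ext ⟨x, y⟩
    simp only [SetLike.mem_coe, Set.mem_preimage, LinearPMap.mem_graph_iff]
    constructor
    · rintro ⟨u, rfl, rfl⟩
      exact ⟨u, rfl, (sub_add_cancel _ _).symm⟩
    · rintro ⟨u, rfl, h⟩
      exact ⟨u, rfl, sub_eq_of_eq_add h⟩
  rw [LinearPMap.IsClosed, h]
  exact IsClosed.preimage (by fun_prop) hT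

lemma fredholmIndex_eq_index (T : E →ₗ.[ℂ] F) : fredholmIndex T = T.toFun.index :=
  LinearMap.index_eq_finrank_sub.symm

end Closed

/-! ### Graphs of the operator matrices and comparison of their indices -/

namespace Data

variable {X Y dX : Type*}
  [NormedAddCommGroup X] [NormedSpace ℂ X] [NormedAddCommGroup Y] [NormedSpace ℂ Y]
  [NormedAddCommGroup dX] [NormedSpace ℂ dX] (S : Data X Y dX)

lemma mem_graph_AR {y : Y} {a : X} {z : dX} :
    (y, (a, z)) ∈ S.AR.graph ↔ ∃ h : y ∈ S.A.domain, S.A ⟨y, h⟩ = a ∧ S.R ⟨y, h⟩ = z := by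
  rw [LinearPMap.mem_graph_iff]
  constructor
  · rintro ⟨u, rfl, h⟩
    exact ⟨u.2, congrArg Prod.fst h, congrArg Prod.snd h⟩
  · rintro ⟨h, rfl, rfl⟩
    exact ⟨⟨y, h⟩, rfl, rfl⟩

/-- The inverse of `ι` need not be continuous for the norm of `X`; this form of the relation is
visibly closed. -/
lemma toY_eq_iff (x : S.YinX) (y : Y) : S.toY x = y ↔ (x : X) = S.ι y := by
  have h : S.toY x = y ↔ x = LinearEquiv.ofInjective (S.ι : Y →ₗ[ℂ] X) S.ι_injective y :=
    LinearEquiv.symm_apply_eq _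
  exact h.trans Subtype.ext_iff

lemma mem_graph_bbA {y y' : Y} {x x' : X} {d d' : dX} :
    ((y, x, d), (y', x', d')) ∈ S.bbA.graph ↔
      ∃ z, (y, (x', z)) ∈ S.AR.graph ∧ x = S.ι y' ∧ d' = z + S.B₂ y := by
  simp only [mem_graph_AR]
  rw [LinearPMap.mem_graph_iff]
  constructor
  · rintro ⟨⟨u, hu⟩, rfl, h⟩
    refine ⟨S.R ⟨y, hu.1⟩, ⟨hu.1, congrArg (fun p => p.2.1) h, rfl⟩, ?_, ?_⟩
    · exact (S.toY_eq_iff ⟨x, hu.2.1⟩ y').1 (congrArg Prod.fst h)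
    · exact (congrArg (fun p => p.2.2) h).symm
  · rintro ⟨z, ⟨hy, rfl, rfl⟩, rfl, rfl⟩
    refine ⟨⟨(y, S.ι y', d), hy, ⟨y', rfl⟩, trivial⟩, rfl, ?_⟩
    exact Prod.ext ((S.toY_eq_iff _ _).2 rfl) rfl

lemma mem_graph_bbR {y : Y} {x : X} {d z : dX} :
    ((y, x, d), z) ∈ S.bbR.graph ↔ (∃ a, (y, (a, z)) ∈ S.AR.graph) ∧ x ∈ S.YinX := by
  simp only [mem_graph_AR]
  rw [LinearPMap.mem_graph_iff]
  constructor
  · rintro ⟨⟨u, hu⟩, rfl, h⟩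
    exact ⟨⟨_, hu.1, rfl, h⟩, hu.2.1⟩
  · rintro ⟨⟨a, hy, rfl, rfl⟩, hx⟩
    exact ⟨⟨(y, x, d), hy, hx, trivial⟩, rfl, rfl⟩

/-- The inclusion `D(𝔸₀) → D(𝔸)`. -/
noncomputable def bbIncl : S.bbA₀.domain →ₗ[ℂ] S.bbDomain := Submodule.inclusion inf_le_right

/-- The first coordinate `D(𝒜) ≃ D(𝔸)`. -/
noncomputable def graphEquiv : S.calA.domain ≃ₗ[ℂ] S.bbDomain :=
  LinearEquiv.ofBijective
    (((LinearMap.fst ℂ (Y × X × dX) dX).comp S.bbR.graph.subtype).codRestrict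
      S.bbDomain fun p => LinearPMap.mem_domain_of_mem_graph (f := S.bbR) p.2)
    ⟨fun p q h => Subtype.ext (S.bbR.mem_graph_snd_inj' p.2 q.2 (congrArg Subtype.val h) |>
      Prod.ext (congrArg Subtype.val h)),
      fun u => ⟨⟨(u.1, S.bbR u), S.bbR.mem_graph u⟩, rfl⟩⟩

lemma bbIncl_injective : Function.Injective S.bbIncl := Submodule.inclusion_injective _

lemma range_bbIncl : LinearMap.range S.bbIncl = LinearMap.ker (S.R.comp S.bbFst) := by
  ext u
  constructor
  · rintro ⟨v, rfl⟩
    obtain ⟨w, hw, hwv⟩ := v.2.1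
    have : S.bbIncl v = w := Subtype.ext hwv.symm
    rw [this]
    exact hw
  · intro hu
    exact ⟨⟨u.1, ⟨u, hu, rfl⟩, u.2⟩, rfl⟩

lemma R_comp_bbFst_surjective (hR : Function.Surjective S.R) :
    Function.Surjective (S.R.comp S.bbFst) := by
  intro z
  obtain ⟨y, rfl⟩ := hR z
  exact ⟨⟨(y.1, 0, 0), y.2, Submodule.zero_mem _, trivial⟩, rfl⟩

/-- The boundary row, with `𝔹` and `B₄`, is forgotten by the projection, so it affects neither
finiteness nor the index. -/
lemma fst_comp_subScalar_calA_toFun (μ : ℂ) :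
    LinearMap.fst ℂ (Y × X × dX) dX ∘ₗ (subScalar S.calA μ).toFun =
      (subScalar S.bbA μ).toFun ∘ₗ S.graphEquiv.toLinearMap := rfl

lemma mem_graph_bbA₀ {y y' : Y} {x x' : X} {d d' : dX} :
    ((y, x, d), (y', x', d')) ∈ S.bbA₀.graph ↔
      (y, (x', 0)) ∈ S.AR.graph ∧ x = S.ι y' ∧ d' = S.B₂ y := by
  simp only [mem_graph_AR]
  rw [LinearPMap.mem_graph_iff]
  constructor
  · rintro ⟨u, hu, h⟩
    have hker : S.R (S.bbFst (S.bbIncl u)) = 0 := by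
      have : S.bbIncl u ∈ LinearMap.ker (S.R.comp S.bbFst) := S.range_bbIncl ▸ ⟨u, rfl⟩
      exact this
    have hg : ((y, x, d), (y', x', d')) ∈ S.bbA.graph :=
      LinearPMap.mem_graph_iff _ |>.2 ⟨S.bbIncl u, hu, h⟩
    obtain ⟨z, hz, hx, hd⟩ := S.mem_graph_bbA.1 hg
    obtain ⟨hy, ha, hz⟩ := S.mem_graph_AR.1 hz
    have hfst : S.bbFst (S.bbIncl u) = ⟨y, hy⟩ := Subtype.ext (congrArg Prod.fst hu)
    rw [hfst, hz] at hker
    subst hker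
    exact ⟨⟨hy, ha, hz⟩, hx, by simpa using hd⟩
  · rintro ⟨⟨hy, rfl, hz⟩, rfl, rfl⟩
    have hu : (y, S.ι y', d) ∈ S.bbDomain := ⟨hy, ⟨y', rfl⟩, trivial⟩
    refine ⟨⟨(y, S.ι y', d), ⟨⟨_, hu⟩, hz, rfl⟩, hu⟩, rfl, ?_⟩
    refine Prod.ext ((S.toY_eq_iff _ _).2 rfl) (Prod.ext rfl ?_)
    change S.R ⟨y, hy⟩ + S.B₂ y = S.B₂ y
    rw [hz, zero_add]

/-- The boundary value `z` is itself a coordinate, so the only unbounded condition is membership in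
the graph of `(A, R)`. -/
lemma mem_graph_calA {u w : Y × X × dX} {z q : dX} :
    ((u, z), (w, q)) ∈ S.calA.graph ↔
      (u.1, (w.2.1, z)) ∈ S.AR.graph ∧ u.2.1 = S.ι w.1 ∧ w.2.2 = z + S.B₂ u.1 ∧
        q = S.bbB u + S.B₄ z := by
  obtain ⟨y, x, d⟩ := u
  obtain ⟨y', x', d'⟩ := w
  rw [LinearPMap.mem_graph_iff]
  constructor
  · rintro ⟨⟨p, hp⟩, rfl, h⟩
    obtain ⟨⟨a, ha⟩, -⟩ := S.mem_graph_bbR.1 hp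
    have hg : ((y, x, d), (y', x', d')) ∈ S.bbA.graph :=
      LinearPMap.mem_graph_iff _ |>.2
        ⟨S.graphEquiv ⟨((y, x, d), z), hp⟩, rfl, congrArg Prod.fst h⟩
    obtain ⟨z', hz', hx, hd⟩ := S.mem_graph_bbA.1 hg
    -- The boundary values obtained from `bbR` and from `bbA` agree because the graph of `(A, R)` is
    -- single-valued.
    have hpair : (a, z) = (x', z') := S.AR.mem_graph_snd_inj ha hz' rfl
    obtain ⟨rfl, rfl⟩ := Prod.mk.inj hpair
    exact ⟨ha, hx, hd, (congrArg Prod.snd h).symm⟩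
  · intro h
    dsimp only at h
    obtain ⟨h, rfl, rfl, rfl⟩ := h
    have hp : ((y, S.ι y', d), z) ∈ S.bbR.graph := S.mem_graph_bbR.2 ⟨⟨_, h⟩, ⟨y', rfl⟩⟩
    refine ⟨⟨_, hp⟩, rfl, Prod.ext ?_ rfl⟩
    obtain ⟨hy, rfl, rfl⟩ := S.mem_graph_AR.1 h
    exact Prod.ext ((S.toY_eq_iff _ _).2 rfl) rfl

lemma isClosed_bbA₀ (h : S.AR.IsClosed) : S.bbA₀.IsClosed := by
  have hset : (S.bbA₀.graph : Set ((Y × X × dX) × (Y × X × dX))) =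
      {p | (p.1.1, (p.2.2.1, (0 : dX))) ∈ S.AR.graph} ∩
        ({p | p.1.2.1 = S.ι p.2.1} ∩ {p | p.2.2.2 = S.B₂ p.1.1}) :=
    Set.ext fun _ => S.mem_graph_bbA₀
  rw [LinearPMap.IsClosed, hset]
  exact (IsClosed.preimage (by fun_prop) h).inter
    ((isClosed_eq (by fun_prop) (by fun_prop)).inter (isClosed_eq (by fun_prop) (by fun_prop)))

lemma isClosed_calA (h : S.AR.IsClosed) : S.calA.IsClosed := by
  have hset : (S.calA.graph : Set (((Y × X × dX) × dX) × ((Y × X × dX) × dX))) =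
      {p | (p.1.1.1, (p.2.1.2.1, p.1.2)) ∈ S.AR.graph} ∩
        ({p | p.1.1.2.1 = S.ι p.2.1.1} ∩ ({p | p.2.1.2.2 = p.1.2 + S.B₂ p.1.1.1} ∩
          {p | p.2.2 = S.bbB p.1.1 + S.B₄ p.1.2})) :=
    Set.ext fun _ => S.mem_graph_calA
  rw [LinearPMap.IsClosed, hset]
  exact (IsClosed.preimage (by fun_prop) h).inter
    ((isClosed_eq (by fun_prop) (by fun_prop)).inter
      ((isClosed_eq (by fun_prop) (by fun_prop)).inter (isClosed_eq (by fun_prop) (by fun_prop))))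

lemma hasFiniteIndex_subScalar_calA_iff [FiniteDimensional ℂ dX]
    (hR : Function.Surjective S.R) (μ : ℂ) :
    HasFiniteIndex (subScalar S.calA μ).toFun ↔ HasFiniteIndex (subScalar S.bbA₀ μ).toFun :=
  hasFiniteIndex_iff_of_fst_comp (f := (subScalar S.bbA μ).toFun) S.bbIncl_injective
    (S.R_comp_bbFst_surjective hR) S.range_bbIncl S.graphEquiv (S.fst_comp_subScalar_calA_toFun μ)

lemma index_subScalar_calA [FiniteDimensional ℂ dX] (hR : Function.Surjective S.R) {μ : ℂ}
    (h : HasFiniteIndex (subScalar S.bbA₀ μ).toFun) :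
    (subScalar S.calA μ).toFun.index = (subScalar S.bbA₀ μ).toFun.index :=
  index_eq_of_fst_comp (f := (subScalar S.bbA μ).toFun) S.bbIncl_injective
    (S.R_comp_bbFst_surjective hR) S.range_bbIncl S.graphEquiv (S.fst_comp_subScalar_calA_toFun μ) h

end Data

end Acoustic

theorem proposition3p14 {X Y dX : Type*}
    [NormedAddCommGroup X] [NormedSpace ℂ X] [CompleteSpace X]
    [NormedAddCommGroup Y] [NormedSpace ℂ Y] [CompleteSpace Y]
    [NormedAddCommGroup dX] [NormedSpace ℂ dX] [CompleteSpace dX]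
    (S : Acoustic.Data X Y dX) (hS : S.Assumptions) (hdX : FiniteDimensional ℂ dX) :
    Acoustic.essentialSpectrum S.calA = Acoustic.essentialSpectrum S.bbA₀ ∧
      ∀ μ : ℂ, μ ∉ Acoustic.essentialSpectrum S.bbA₀ →
        Acoustic.fredholmIndex (Acoustic.subScalar S.calA μ) =
          Acoustic.fredholmIndex (Acoustic.subScalar S.bbA₀ μ) := by
  have hbbA₀ (μ : ℂ) := Acoustic.isFredholm_iff_of_isClosed
    (Acoustic.isClosed_subScalar (S.isClosed_bbA₀ hS.AR_closed) μ)
  have hcalA (μ : ℂ) := Acoustic.isFredholm_iff_of_isClosed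
    (Acoustic.isClosed_subScalar (S.isClosed_calA hS.AR_closed) μ)
  have hiff (μ : ℂ) : Acoustic.IsFredholm (Acoustic.subScalar S.calA μ) ↔
      Acoustic.IsFredholm (Acoustic.subScalar S.bbA₀ μ) :=
    (hcalA μ).trans ((S.hasFiniteIndex_subScalar_calA_iff hS.R_surjective μ).trans (hbbA₀ μ).symm)
  refine ⟨Set.ext fun μ => not_congr (hiff μ), fun μ hμ => ?_⟩
  rw [Acoustic.fredholmIndex_eq_index, Acoustic.fredholmIndex_eq_index]
  exact S.index_subScalar_calA hS.R_surjective ((hbbA₀ μ).1 (not_not.1 hμ))
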